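/- Let $\mathcal G=([p],E)$ be a directed acyclic graph, let $X_{[p]}=(X_1,\dots,X_p)$ be discrete random variables with finite state spaces $\mathcal R_{\{i\}}$, each with at least two elements, and let $\mathcal R=\prod_{i}\mathcal R_{\{i\}}$ and $\mathcal R_S=\prod_{i\in S}\mathcal R_{\{i\}}$ for $S\subseteq[p]$; write $\mathbf x_S$ for the restriction of $\mathbf x$ to $S$. Call $\mathcal G$ *perfect* if for every $k$ any two distinct parents of $k$ are joined by an edge. Let $\mathbb R[D]=\mathbb R[p_{\mathbf x}:\mathbf x\in\mathcal R]$. (a) Let $U$ be the set of indeterminates $q_{i;x_i;\mathbf x_{\mathrm{pa}(i)}}$ with $i\in[p]$, $x_i\in\mathcal R_{\{i\}}$, $\mathbf x_{\mathrm{pa}(i)}\in\mathcal R_{\mathrm{pa}(i)}$, let $z$ be a further (homogenizing) indeterminate, and let $\mathfrak q$ be the ideal of $\mathbb R[z,U]$ generated by all $1-\sum_{x_i\in\mathcal R_{\{i\}}}q_{i;x_i;\mathbf x_{\mathrm{pa}(i)}}$. Let $\Phi_{\mathcal G}:\mathbb R[D]\to\mathbb R[z,U]/\mathfrak q$ be the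 $\mathbb R$-algebra map $p_{\mathbf x}\mapsto z\prod_{i\in[p]}q_{i;x_i;\mathbf x_{\mathrm{pa}(i)}}$. (b) Let $\tilde{\mathcal G}$ be the skeleton (underlying undirected graph) of $\mathcal G$ and $\mathcal C$ its set of maximal cliques. Let $\Phi_{\tilde{\mathcal G}}:\mathbb R[D]\to\mathbb R[\phi_{\mathbf x_C}:C\in\mathcal C,\ \mathbf x_C\in\mathcal R_C]$ be the $\mathbb R$-algebra map $p_{\mathbf x}\mapsto\prod_{C\in\mathcal C}\phi_{\mathbf x_C}$. (c) Let $\pi$ be a linear extension of $\mathcal G$. Let $\mathcal T_{\mathcal G}$ be the rooted tree whose vertices of level $k\in\{0,\dots,p\}$ are the elements of $\mathcal R_{\{\pi_1,\dots,\pi_k\}}$ (the root being the only vertex of level $0$), with an edge from $x_{\pi_1}\cdots x_{\pi_k}$ to each of its extensions $x_{\pi_1}\cdots x_{\pi_k}x_{\pi_{k+1}}$, $0\le k<p$; label this edge with the symbol $\theta(e)=f(x_{\pi_{k+1}}\mid\mathbf x_{\mathrm{pa}(\pi_{k+1})})$. This is a staged tree. Its leaves are the elements of $\mathcal R$; for $\mathbf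 x\in\mathcal R$ let $\lambda(\mathbf x)$ be the set of edges on the path from the root to $\mathbf x$. Let $\mathcal L$ be the set of labels, let $E(v)$ be the set of edges leaving a vertex $v$, and let $\mathfrak q'\subseteq\mathbb R[z,\mathcal L]$ be the ideal generated by all $1-\sum_{e\in E(v)}\theta(e)$, $v$ a non-leaf vertex. Let $\Psi^{\mathsf{toric}}_{\mathcal T_{\mathcal G}}:\mathbb R[D]\to\mathbb R[z,\mathcal L]$ and $\Psi_{\mathcal T_{\mathcal G}}:\mathbb R[D]\to\mathbb R[z,\mathcal L]/\mathfrak q'$ be the $\mathbb R$-algebra maps given by $p_{\mathbf x}\mapsto z\prod_{e\in\lambda(\mathbf x)}\theta(e)$. Then, for every such $\mathcal G$ and every linear extension $\pi$, the following are equivalent: 1. $\mathcal G$ is perfect; 2. $\ker(\Phi_{\mathcal G})=\ker(\Phi_{\tilde{\mathcal G}})$; 3. $\ker(\Psi_{\mathcal T_{\mathcal G}})=\ker(\Psi^{\mathsf{toric}}_{\mathcal T_{\mathcal G}})$. If any of (1), (2), (3) holds, then $\ker(\Phi_{\tilde{\mathcal G}})=\ker(\Phi_{\mathcal G})=\ker(\Psi_{\mathcal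 T_{\mathcal G}})=\ker(\Psi^{\mathsf{toric}}_{\mathcal T_{\mathcal G}})$. -/

import Mathlib

open MvPolynomial

/-! ### Directed acyclic graphs -/

/-- `G` has no directed cycle. -/
def Digraph.IsDAG {V : Type*} (G : Digraph V) : Prop :=
  ∀ v, ¬ Relation.TransGen G.Adj v v

/-- The set of parents of `v`. -/
def Digraph.parents {V : Type*} (G : Digraph V) (v : V) : Set V := {w | G.Adj w v}

/-- The underlying undirected graph. -/
abbrev Digraph.skeleton {V : Type*} (G : Digraph V) : SimpleGraph V :=
  G.toSimpleGraphInclusive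

/-- For every vertex, the subgraph induced on its parents is complete. -/
def Digraph.IsPerfectDAG {V : Type*} (G : Digraph V) : Prop :=
  ∀ k, ∀ i ∈ G.parents k, ∀ j ∈ G.parents k, i ≠ j → G.Adj i j ∨ G.Adj j i

/-- `π k` is the vertex in position `k` of the ordering; `π.symm i` is the position of `i`. -/
def Digraph.IsLinearExtension {p : ℕ} (G : Digraph (Fin p)) (π : Equiv.Perm (Fin p)) : Prop :=
  ∀ i j, G.Adj i j → π.symm i < π.symm j

/-! ### State spaces -/

/-- The state space of the subvector `X_S`; the state space of `X_i` is `R i`. -/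
abbrev SubState {p : ℕ} (R : Fin p → Type*) (S : Set (Fin p)) := (i : S) → R i

/-! ### The two parametrizations of a DAG and its skeleton -/

/-- Index set of the indeterminates `q_{i; x_i; x_{pa(i)}}`. -/
abbrev CondIndex {p : ℕ} (R : Fin p → Type*) (G : Digraph (Fin p)) :=
  (i : Fin p) × (R i × SubState R (G.parents i))

/-- The ideal generated by all `1 - ∑_{x_i} q_{i; x_i; x_{pa(i)}}`.  The indeterminate indexed by
`none` is the homogenizing variable `z`. -/
noncomputable def dagIdeal {p : ℕ} (R : Fin p → Type*) [∀ i, Fintype (R i)]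
    (G : Digraph (Fin p)) : Ideal (MvPolynomial (Option (CondIndex R G)) ℝ) :=
  Ideal.span (Set.range fun a : (i : Fin p) × SubState R (G.parents i) =>
    1 - ∑ s : R a.1, X (some (⟨a.1, (s, a.2)⟩ : CondIndex R G)))

/-- `Φ_G : p_x ↦ z ∏_i q_{i; x_i; x_{pa(i)}}`. -/
noncomputable def phiDAG {p : ℕ} (R : Fin p → Type*) [∀ i, Fintype (R i)]
    (G : Digraph (Fin p)) :
    MvPolynomial ((i : Fin p) → R i) ℝ →ₐ[ℝ]
      (MvPolynomial (Option (CondIndex R G)) ℝ ⧸ dagIdeal R G) :=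
  aeval fun x => Ideal.Quotient.mk (dagIdeal R G)
    (X none * ∏ i, X (some ⟨i, (x i, fun j => x j)⟩))

/-- The maximal cliques of an undirected graph. -/
abbrev MaxClique {V : Type*} (H : SimpleGraph V) := {C : Set V // Maximal H.IsClique C}

noncomputable instance {V : Type*} [Finite V] (H : SimpleGraph V) : Fintype (MaxClique H) :=
  Fintype.ofFinite _

/-- `p_x ↦ ∏_C φ_{x_C}`, the product over all maximal cliques. -/
noncomputable def phiCliques {p : ℕ} (R : Fin p → Type*) (H : SimpleGraph (Fin p)) :
    MvPolynomial ((i : Fin p) → R i) ℝ →ₐ[ℝ]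
      MvPolynomial ((C : MaxClique H) × SubState R C.1) ℝ :=
  aeval fun x => ∏ C : MaxClique H, X ⟨C, fun j => x j⟩

/-! ### Staged trees -/

/-- A staged tree with vertex set `V` and edge labels in `L`. -/
structure StagedTree (V L : Type*) where
  graph : Digraph V
  root : V
  asymm : ∀ v w, graph.Adj v w → ¬ graph.Adj w v
  isTree : graph.skeleton.IsTree
  parents_eq_empty_iff : ∀ v, graph.parents v = ∅ ↔ v = root
  /-- The labelling of the edges `v → w`. -/
  label : {e : V × V // graph.Adj e.1 e.2} → L
  label_injOn : ∀ v, Set.InjOn label {e | e.1.1 = v}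
  label_eq_or_disjoint : ∀ v w,
    label '' {e | e.1.1 = v} = label '' {e | e.1.1 = w} ∨
      Disjoint (label '' {e | e.1.1 = v}) (label '' {e | e.1.1 = w})

namespace StagedTree

variable {V L : Type*}

/-- The edges of the tree. -/
abbrev Edge (T : StagedTree V L) := {e : V × V // T.graph.Adj e.1 e.2}

noncomputable instance [Finite V] (T : StagedTree V L) : Fintype T.Edge := Fintype.ofFinite _

/-- `v` has no children. -/
def IsLeaf (T : StagedTree V L) (v : V) : Prop := ∀ w, ¬ T.graph.Adj v w

/-- The leaves of the tree. -/
abbrev Leaf (T : StagedTree V L) := {v : V // T.IsLeaf v}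

open Classical in
/-- `E(v)`, the set of edges from `v` to its children. -/
noncomputable def outEdges [Finite V] (T : StagedTree V L) (v : V) : Finset T.Edge :=
  {e | e.1.1 = v}

open Classical in
/-- `λ(v)`, the set of edges on the unique directed path from the root to `v`.  In a rooted tree
these are the edges `u → w` from whose endpoint `w` there is a directed path to `v`. -/
noncomputable def rootPath [Finite V] (T : StagedTree V L) (v : V) : Finset T.Edge :=
  {e | Relation.ReflTransGen T.graph.Adj e.1.2 v}

/-- The ideal generated by all `1 - ∑_{e ∈ E(v)} θ(e)`, `v` not a leaf.  The indeterminate indexed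
by `none` is `z`. -/
noncomputable def stageIdeal [Finite V] (T : StagedTree V L) :
    Ideal (MvPolynomial (Option L) ℝ) :=
  Ideal.span {f | ∃ v, ¬ T.IsLeaf v ∧ f = 1 - ∑ e ∈ T.outEdges v, X (some (T.label e))}

/-- The toric map `p_x ↦ z ∏_{e ∈ λ(v)} θ(e)`, where `v` is the leaf identified with the
outcome `x`. -/
noncomputable def psiToric [Finite V] (T : StagedTree V L) {D : Type*} (leaf : D ≃ T.Leaf) :
    MvPolynomial D ℝ →ₐ[ℝ] MvPolynomial (Option L) ℝ :=
  aeval fun x => X none * ∏ e ∈ T.rootPath (leaf x).1, X (some (T.label e))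

/-- The same map with values in the quotient by `stageIdeal`. -/
noncomputable def psi [Finite V] (T : StagedTree V L) {D : Type*} (leaf : D ≃ T.Leaf) :
    MvPolynomial D ℝ →ₐ[ℝ] (MvPolynomial (Option L) ℝ ⧸ T.stageIdeal) :=
  aeval fun x => Ideal.Quotient.mk T.stageIdeal
    (X none * ∏ e ∈ T.rootPath (leaf x).1, X (some (T.label e)))

end StagedTree

/-! ### The staged tree of a DAG and a linear extension -/

/-- The vertices: pairs of a level `k` and an outcome of the first `k` variables in the
ordering `π`.  The only vertex of level `0` is the root. -/
abbrev DAGTreeVertex {p : ℕ} (R : Fin p → Type*) (π : Equiv.Perm (Fin p)) :=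
  (k : Fin (p + 1)) × SubState R {i | (π.symm i : ℕ) < k}

/-- Edges go from an outcome of the first `k` variables to its extensions to the first `k + 1`
variables. -/
def dagTreeGraph {p : ℕ} (R : Fin p → Type*) (π : Equiv.Perm (Fin p)) :
    Digraph (DAGTreeVertex R π) where
  Adj a b := (b.1 : ℕ) = a.1 + 1 ∧
    ∀ (i : Fin p) (ha : (π.symm i : ℕ) < a.1) (hb : (π.symm i : ℕ) < b.1),
      b.2 ⟨i, hb⟩ = a.2 ⟨i, ha⟩

section DAGTree

variable {p : ℕ} {R : Fin p → Type*} {π : Equiv.Perm (Fin p)}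

theorem DAGTreeVertex.ext' {a b : DAGTreeVertex R π} (h : (a.1 : ℕ) = b.1)
    (h2 : ∀ (i : Fin p) (ha : (π.symm i : ℕ) < a.1) (hb : (π.symm i : ℕ) < b.1),
      a.2 ⟨i, ha⟩ = b.2 ⟨i, hb⟩) : a = b := by
  obtain ⟨k, x⟩ := a
  obtain ⟨l, y⟩ := b
  obtain rfl : k = l := Fin.ext h
  congr 1
  funext i
  exact h2 i.1 i.2 i.2

theorem dagTreeGraph_lt {a b : DAGTreeVertex R π} (h : (dagTreeGraph R π).Adj a b) :
    (a.1 : ℕ) < p := by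
  have := h.1; have := b.1.2; omega

/-- The variable `π_{k+1}` attached to an edge between the levels `k` and `k + 1`. -/
def edgeVar (e : {e : DAGTreeVertex R π × DAGTreeVertex R π // (dagTreeGraph R π).Adj e.1 e.2}) :
    Fin p :=
  π ⟨e.1.1.1, dagTreeGraph_lt e.2⟩

theorem symm_edgeVar
    (e : {e : DAGTreeVertex R π × DAGTreeVertex R π // (dagTreeGraph R π).Adj e.1 e.2}) :
    (π.symm (edgeVar e) : ℕ) = e.1.1.1 := by simp [edgeVar]

/-- The label `f(x_{π_{k+1}} | x_{pa(π_{k+1})})` of the edge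
`x_{π_1} ⋯ x_{π_k} → x_{π_1} ⋯ x_{π_k} x_{π_{k+1}}`. -/
def dagTreeLabel (G : Digraph (Fin p)) (hπ : G.IsLinearExtension π)
    (e : {e : DAGTreeVertex R π × DAGTreeVertex R π // (dagTreeGraph R π).Adj e.1 e.2}) :
    CondIndex R G :=
  ⟨edgeVar e,
    (e.1.2.2 ⟨edgeVar e, by
        have h1 := symm_edgeVar e
        have h2 := e.2.1
        simp only [Set.mem_ofPred_eq]; omega⟩,
      fun j => e.1.1.2 ⟨j, by
        have h1 := symm_edgeVar e
        have h2 : (π.symm j : ℕ) < π.symm (edgeVar e) := hπ _ _ j.2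
        simp only [Set.mem_ofPred_eq]; omega⟩)⟩

/-- The root, i.e. the empty outcome. -/
def dagTreeRoot (R : Fin p → Type*) (π : Equiv.Perm (Fin p)) : DAGTreeVertex R π :=
  ⟨0, fun i => absurd i.2 (by simp)⟩

theorem eq_dagTreeRoot {v : DAGTreeVertex R π} (h : (v.1 : ℕ) = 0) : v = dagTreeRoot R π :=
  DAGTreeVertex.ext' (by simpa [dagTreeRoot] using h) fun i ha => by omega

/-- The parent of a vertex of positive level. -/
theorem exists_dagTree_parent {v : DAGTreeVertex R π} (h : (v.1 : ℕ) ≠ 0) :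
    ∃ u, (dagTreeGraph R π).Adj u v := by
  have := v.1.2
  exact ⟨⟨⟨v.1 - 1, by omega⟩, fun i => v.2 ⟨i, by
    have := i.2
    simp only [Set.mem_ofPred_eq] at this ⊢; omega⟩⟩,
    by simp only; omega, fun i ha hb => rfl⟩

theorem dagTree_parent_unique {u u' v : DAGTreeVertex R π} (h : (dagTreeGraph R π).Adj u v)
    (h' : (dagTreeGraph R π).Adj u' v) : u = u' := by
  have h1 := h.1
  have h2 := h'.1
  exact DAGTreeVertex.ext' (by omega) fun i ha hb => by
    rw [← h.2 i ha (by omega), ← h'.2 i hb (by omega)]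

theorem dagTree_asymm (a b : DAGTreeVertex R π) (h : (dagTreeGraph R π).Adj a b) :
    ¬ (dagTreeGraph R π).Adj b a := by
  intro h'
  have := h.1
  have := h'.1
  omega

theorem dagTree_parents_eq_empty_iff (v : DAGTreeVertex R π) :
    (dagTreeGraph R π).parents v = ∅ ↔ v = dagTreeRoot R π := by
  constructor
  · intro h
    refine eq_dagTreeRoot ?_
    by_contra h0
    obtain ⟨u, hu⟩ := exists_dagTree_parent h0
    exact (Set.eq_empty_iff_forall_notMem.1 h u) hu
  · rintro rfl
    refine Set.eq_empty_iff_forall_notMem.2 fun u hu => ?_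
    have : ((dagTreeRoot R π).1 : ℕ) = u.1 + 1 := hu.1
    simp [dagTreeRoot] at this

theorem dagTree_reachable (n : ℕ) : ∀ v : DAGTreeVertex R π, (v.1 : ℕ) = n →
    (dagTreeGraph R π).skeleton.Reachable (dagTreeRoot R π) v := by
  induction n with
  | zero => intro v hv; rw [eq_dagTreeRoot hv]
  | succ n ih =>
    intro v hv
    obtain ⟨u, hu⟩ := exists_dagTree_parent (v := v) (by omega)
    have h1 := hu.1
    refine (ih u (by omega)).trans (SimpleGraph.Adj.reachable ?_)
    refine ⟨?_, Or.inl hu⟩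
    rintro rfl
    omega

theorem dagTree_bridge {u w : DAGTreeVertex R π} (h : (dagTreeGraph R π).Adj u w) :
    ¬ ((dagTreeGraph R π).skeleton.deleteEdges {s(u, w)}).Reachable u w := by
  intro hr
  let S : Set (DAGTreeVertex R π) := {v | (w.1 : ℕ) ≤ v.1 ∧
    ∀ (i : Fin p) (hw : (π.symm i : ℕ) < w.1) (hv : (π.symm i : ℕ) < v.1),
      v.2 ⟨i, hv⟩ = w.2 ⟨i, hw⟩}
  have key : ∀ a b, (dagTreeGraph R π).Adj a b → s(a, b) ≠ s(u, w) → (a ∈ S ↔ b ∈ S) := by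
    intro a b hab hne
    have hl := hab.1
    constructor
    · rintro ⟨h1, h2⟩
      exact ⟨by omega, fun i hw hv => by rw [hab.2 i (by omega) hv, h2 i hw]⟩
    · rintro ⟨h1, h2⟩
      by_cases hlt : (w.1 : ℕ) ≤ a.1
      · exact ⟨hlt, fun i hw hv => by rw [← h2 i hw (by omega), hab.2 i hv]⟩
      · exfalso
        have hbw : b = w := DAGTreeVertex.ext' (by omega) fun i hb hw => h2 i hw hb
        subst hbw
        exact hne (by rw [dagTree_parent_unique hab h])
  have hS : ∀ a b, ((dagTreeGraph R π).skeleton.deleteEdges {s(u, w)}).Reachable a b →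
      (a ∈ S → b ∈ S) := by
    rintro a b ⟨q⟩
    induction q with
    | nil => exact id
    | cons hadj _ ih =>
      intro ha
      refine ih ?_
      rw [SimpleGraph.deleteEdges_adj] at hadj
      obtain ⟨⟨_, h1 | h1⟩, h2⟩ := hadj
      · exact (key _ _ h1 h2).1 ha
      · exact (key _ _ h1 (by rw [Sym2.eq_swap]; exact h2)).2 ha
  have hw : w ∈ S := ⟨le_rfl, fun _ _ _ => rfl⟩
  have hu := hS w u hr.symm hw
  have h1 := h.1
  have h2 := hu.1
  omega

theorem dagTree_isTree : (dagTreeGraph R π).skeleton.IsTree := by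
  have : Nonempty (DAGTreeVertex R π) := ⟨dagTreeRoot R π⟩
  refine ⟨⟨?_⟩, ?_⟩
  · intro a b
    exact (dagTree_reachable _ a rfl).symm.trans (dagTree_reachable _ b rfl)
  · rw [SimpleGraph.isAcyclic_iff_forall_adj_isBridge]
    rintro u w ⟨_, h | h⟩
    · exact (SimpleGraph.isBridge_iff).2 (dagTree_bridge h)
    · rw [Sym2.eq_swap]
      exact (SimpleGraph.isBridge_iff).2 (dagTree_bridge h)

theorem edgeVar_eq_of_level
    {e e' : {e : DAGTreeVertex R π × DAGTreeVertex R π // (dagTreeGraph R π).Adj e.1 e.2}}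
    (h : (e.1.1.1 : ℕ) = e'.1.1.1) : edgeVar e = edgeVar e' := by
  unfold edgeVar
  congr 1
  exact Fin.ext h

theorem dagTreeLabel_eq (G : Digraph (Fin p)) (hπ : G.IsLinearExtension π)
    (e : {e : DAGTreeVertex R π × DAGTreeVertex R π // (dagTreeGraph R π).Adj e.1 e.2})
    (i : Fin p) (hi : edgeVar e = i) (h1 : (π.symm i : ℕ) < e.1.2.1)
    (h2 : ∀ j ∈ G.parents i, (π.symm j : ℕ) < e.1.1.1) :
    dagTreeLabel G hπ e = ⟨i, (e.1.2.2 ⟨i, h1⟩, fun j => e.1.1.2 ⟨j, h2 j j.2⟩)⟩ := by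
  subst hi
  rfl

/-- Equal labels occur on edges of the same level, with the same value of the new variable and
of its parents. -/
theorem dagTreeLabel_inj (G : Digraph (Fin p)) (hπ : G.IsLinearExtension π)
    {e e' : {e : DAGTreeVertex R π × DAGTreeVertex R π // (dagTreeGraph R π).Adj e.1 e.2}}
    (h : dagTreeLabel G hπ e = dagTreeLabel G hπ e') :
    (e.1.1.1 : ℕ) = e'.1.1.1 ∧
    (∀ (h1 : (π.symm (edgeVar e) : ℕ) < e.1.2.1) (h2 : (π.symm (edgeVar e) : ℕ) < e'.1.2.1),
      e.1.2.2 ⟨edgeVar e, h1⟩ = e'.1.2.2 ⟨edgeVar e, h2⟩) ∧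
    (∀ j ∈ G.parents (edgeVar e), ∀ (h1 : (π.symm j : ℕ) < e.1.1.1)
      (h2 : (π.symm j : ℕ) < e'.1.1.1), e.1.1.2 ⟨j, h1⟩ = e'.1.1.2 ⟨j, h2⟩) := by
  have hvar : edgeVar e = edgeVar e' := congrArg Sigma.fst h
  have hlev : (e.1.1.1 : ℕ) = e'.1.1.1 := by
    rw [← symm_edgeVar e, ← symm_edgeVar e', hvar]
  have hs := symm_edgeVar e
  have hl := e.2.1
  have hl' := e'.2.1
  have hp : ∀ j ∈ G.parents (edgeVar e), (π.symm j : ℕ) < e.1.1.1 := fun j hj => by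
    have : (π.symm j : ℕ) < π.symm (edgeVar e) := hπ _ _ hj
    omega
  rw [dagTreeLabel_eq G hπ e (edgeVar e) rfl (by omega) hp,
    dagTreeLabel_eq G hπ e' (edgeVar e) hvar.symm (by omega)
      (fun j hj => by have := hp j hj; omega)] at h
  have h' := eq_of_heq (Sigma.mk.inj h).2
  refine ⟨hlev, fun _ _ => congrArg Prod.fst h', fun j hj _ _ => ?_⟩
  exact congrFun (congrArg Prod.snd h') ⟨j, hj⟩

theorem dagTreeLabel_injOn (G : Digraph (Fin p)) (hπ : G.IsLinearExtension π)
    (v : DAGTreeVertex R π) :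
    Set.InjOn (dagTreeLabel (R := R) G hπ) {e | e.1.1 = v} := by
  rintro ⟨⟨a, b⟩, hab⟩ (rfl : a = v) ⟨⟨a', b'⟩, hab'⟩ (h : a' = a) hl
  subst h
  have hb : b = b' := by
    have h1 := hab.1
    have h2 := hab'.1
    refine DAGTreeVertex.ext' (by simp only at h1 h2; omega) fun i hb hb' => ?_
    by_cases hi : (π.symm i : ℕ) < a'.1
    · rw [hab.2 i hi hb, hab'.2 i hi hb']
    · have : edgeVar ⟨(a', b), hab⟩ = i := by
        apply π.symm.injective
        apply Fin.ext
        rw [symm_edgeVar]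
        simp only at h1 ⊢
        omega
      subst this
      exact (dagTreeLabel_inj G hπ hl).2.1 hb hb'
  subst hb
  rfl

/-- The extension of an outcome of the first `k` variables by a value of the next one. -/
theorem exists_dagTree_child (v : DAGTreeVertex R π) (i : Fin p)
    (hi : (π.symm i : ℕ) = v.1) (s : R i) :
    ∃ w, (dagTreeGraph R π).Adj v w ∧
      ∀ h : (π.symm i : ℕ) < w.1, w.2 ⟨i, h⟩ = s := by
  classical
  have hp := (π.symm i).2
  refine ⟨⟨⟨v.1 + 1, by omega⟩, fun j =>
    if hj : (π.symm j : ℕ) < v.1 then v.2 ⟨j, hj⟩ else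
      cast (congrArg R (π.symm.injective (Fin.ext (by
        have := j.2
        simp only [Set.mem_ofPred_eq] at this
        omega)))) s⟩, ⟨rfl, ?_⟩, ?_⟩
  · intro j ha hb
    simp only [ha, dif_pos]
  · intro h
    have : ¬ ((π.symm i : ℕ) < v.1) := by omega
    simp only [this, dif_neg, not_false_iff, cast_eq]

theorem dagTreeLabel_subset (G : Digraph (Fin p)) (hπ : G.IsLinearExtension π)
    {e e' : {e : DAGTreeVertex R π × DAGTreeVertex R π // (dagTreeGraph R π).Adj e.1 e.2}}
    (h : dagTreeLabel G hπ e = dagTreeLabel G hπ e') :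
    dagTreeLabel G hπ '' {f | f.1.1 = e.1.1} ⊆ dagTreeLabel G hπ '' {f | f.1.1 = e'.1.1} := by
  rintro _ ⟨f, hf : f.1.1 = e.1.1, rfl⟩
  obtain ⟨hlev, -, hpar⟩ := dagTreeLabel_inj G hπ h
  have hflev : (f.1.1.1 : ℕ) = e.1.1.1 := by rw [hf]
  have hvar : edgeVar f = edgeVar e := edgeVar_eq_of_level hflev
  have hs := symm_edgeVar f
  have hl := f.2.1
  have hp : ∀ j ∈ G.parents (edgeVar f), (π.symm j : ℕ) < f.1.1.1 := fun j hj => by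
    have : (π.symm j : ℕ) < π.symm (edgeVar f) := hπ _ _ hj
    omega
  obtain ⟨w, hw, hws⟩ := exists_dagTree_child e'.1.1 (edgeVar f) (by omega)
    (f.1.2.2 ⟨edgeVar f, by simp only [Set.mem_ofPred_eq]; omega⟩)
  have hwl := hw.1
  refine ⟨⟨(e'.1.1, w), hw⟩, rfl, ?_⟩
  rw [dagTreeLabel_eq G hπ ⟨(e'.1.1, w), hw⟩ (edgeVar f)
      (edgeVar_eq_of_level (by simp only; omega)) (by simp only; omega)
      (fun j hj => by have := hp j hj; simp only; omega),
    dagTreeLabel_eq G hπ f (edgeVar f) rfl (by omega) hp]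
  refine congrArg (Sigma.mk (edgeVar f)) (Prod.ext (hws _) (funext fun j => ?_))
  obtain ⟨⟨a, b⟩, hab⟩ := f
  obtain rfl : a = e.1.1 := hf
  exact (hpar j (by rw [← hvar]; exact j.2) _ _).symm

theorem dagTreeLabel_eq_or_disjoint (G : Digraph (Fin p)) (hπ : G.IsLinearExtension π)
    (v w : DAGTreeVertex R π) :
    dagTreeLabel G hπ '' {e | e.1.1 = v} = dagTreeLabel G hπ '' {e | e.1.1 = w} ∨
      Disjoint (dagTreeLabel G hπ '' {e | e.1.1 = v}) (dagTreeLabel G hπ '' {e | e.1.1 = w}) := by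
  refine or_iff_not_imp_right.2 fun h => ?_
  obtain ⟨_, ⟨e, rfl, rfl⟩, ⟨e', rfl, h'⟩⟩ := Set.not_disjoint_iff.1 h
  exact Set.Subset.antisymm (dagTreeLabel_subset G hπ h'.symm) (dagTreeLabel_subset G hπ h')

/-- The staged tree of a DAG `G` with respect to a linear extension `π`. -/
def dagTree (R : Fin p → Type*) (G : Digraph (Fin p)) (hπ : G.IsLinearExtension π) :
    StagedTree (DAGTreeVertex R π) (CondIndex R G) where
  graph := dagTreeGraph R π
  root := dagTreeRoot R π
  asymm := dagTree_asymm
  isTree := dagTree_isTree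
  parents_eq_empty_iff := dagTree_parents_eq_empty_iff
  label := dagTreeLabel G hπ
  label_injOn := dagTreeLabel_injOn G hπ
  label_eq_or_disjoint := dagTreeLabel_eq_or_disjoint G hπ

theorem dagTree_isLeaf_iff [∀ i, Nonempty (R i)] (G : Digraph (Fin p))
    (hπ : G.IsLinearExtension π) (v : DAGTreeVertex R π) :
    (dagTree R G hπ).IsLeaf v ↔ (v.1 : ℕ) = p := by
  constructor
  · intro h
    by_contra hne
    have hlt : (v.1 : ℕ) < p := by have := v.1.2; omega
    obtain ⟨s⟩ : Nonempty (R (π ⟨v.1, hlt⟩)) := inferInstance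
    obtain ⟨w, hw, -⟩ := exists_dagTree_child v (π ⟨v.1, hlt⟩) (by simp) s
    exact h w hw
  · intro h w hw
    have := dagTreeGraph_lt hw
    omega

/-- The identification of the outcomes of the random vector with the leaves of the tree. -/
def dagTreeLeaf (R : Fin p → Type*) [∀ i, Nonempty (R i)] (G : Digraph (Fin p))
    (hπ : G.IsLinearExtension π) : ((i : Fin p) → R i) ≃ (dagTree R G hπ).Leaf where
  toFun x := ⟨⟨Fin.last p, fun i => x i⟩, (dagTree_isLeaf_iff G hπ _).2 rfl⟩
  invFun v i := v.1.2 ⟨i, by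
    have := (dagTree_isLeaf_iff G hπ v.1).1 v.2
    simp only [Set.mem_ofPred_eq]; omega⟩
  left_inv _ := rfl
  right_inv v := Subtype.ext (DAGTreeVertex.ext'
    ((dagTree_isLeaf_iff G hπ v.1).1 v.2).symm fun _ _ _ => rfl)

end DAGTree

/-! ### Kernels of polynomial maps and evaluations -/

/-! Let K be the kernel of `aeval (dagMonomial R G)`, the DAG parametrization before passing to the
quotient. Along the path to a leaf x each variable contributes one edge, so the tree has the same
monomials, and its sum relations are those of the DAG (`rootPath_monomial`, `stageIdeal_dagTree`).
Hence ker Ψ = ker Φ_G and ker Ψ^toric = K, whatever the linear extension, and it remains to compare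
K, ker Φ_G and the clique kernel.

If G is perfect, K and the clique kernel are the vanishing ideals of the positive functions that
factorize over the sets {i} ∪ pa(i), respectively over the maximal cliques. Each set of one family
lies in a set of the other, so these functions are the same (`factorSet_eq`). Moreover they can be
refactorized with conditional factors that sum to 1 (`exists_normalized`); elements of ker Φ_G
therefore vanish on them, and ker Φ_G = K.

If G is not perfect, some k has nonadjacent parents j and i, with j before i. The independence of
X_i from its other predecessors given its parents yields a quadratic polynomial in ker Φ_G
(`ciPoly_mem_ker_phiDAG`). Let x and y be outcomes that differ exactly in i, j and k. The polynomial
takes the value 1 at the indicator function of {x, y}, yet this function factorizes over both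
families, because k shares a set with i and a set with j (`pairIndicator_eq_prod`). So the
polynomial lies neither in K nor in the clique kernel. -/

theorem eval_aeval_apply {σ D : Type*} (m : D → MvPolynomial σ ℝ) (f : MvPolynomial D ℝ)
    (w : σ → ℝ) : eval w (aeval m f) = eval (fun x => eval w (m x)) f := by
  have key : (eval w).comp (aeval m : MvPolynomial D ℝ →ₐ[ℝ] MvPolynomial σ ℝ).toRingHom =
      eval (fun x => eval w (m x)) := by
    ext <;> simp
  rw [← key]
  rfl

/-- Only the value at `w` is assumed to vanish, so this also serves for kernels modulo an ideal that
vanishes at `w`; and `w` may have zero coordinates, as the indicator functions require. -/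
theorem eval_eq_zero_of_aeval_eq_zero {σ D : Type*} {m : D → MvPolynomial σ ℝ}
    {f : MvPolynomial D ℝ} (w : σ → ℝ) (h : eval w (aeval m f) = 0) :
    eval (fun x => eval w (m x)) f = 0 :=
  (eval_aeval_apply m f w).symm.trans h

/-- The kernel of a polynomial map is the vanishing ideal of its image on the positive orthant. -/
theorem mem_ker_aeval_iff {σ D : Type*} {m : D → MvPolynomial σ ℝ} {f : MvPolynomial D ℝ} :
    f ∈ RingHom.ker (aeval m : MvPolynomial D ℝ →ₐ[ℝ] MvPolynomial σ ℝ) ↔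
      ∀ w : σ → ℝ, (∀ a, 0 < w a) → eval (fun x => eval w (m x)) f = 0 := by
  rw [RingHom.mem_ker]
  constructor
  · intro h w _
    exact eval_eq_zero_of_aeval_eq_zero w (by rw [h, map_zero])
  · intro h
    refine funext_set (fun _ => Set.Ioi (0 : ℝ)) (fun _ => Set.Ioi_infinite _) fun w hw => ?_
    rw [map_zero, eval_aeval_apply, h w fun a => hw a trivial]

/-! ### Positive functions that factorize over a family of sets of variables -/

section Factor

variable {p : ℕ} {R : Fin p → Type*}

theorem DependsOn.mul {ι : Type*} {α : ι → Type*} {f g : (∀ i, α i) → ℝ} {s : Set ι}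
    (hf : DependsOn f s) (hg : DependsOn g s) : DependsOn (fun x => f x * g x) s :=
  fun _ _ h => congrArg₂ _ (hf h) (hg h)

/-- The positive functions of the form `∏ a, u a`, where `u a` depends only on the variables
in `F a`. -/
def factorSet (R : Fin p → Type*) {α : Type*} [Fintype α] (F : α → Set (Fin p)) :
    Set (((i : Fin p) → R i) → ℝ) :=
  {t | ∃ u : α → ((i : Fin p) → R i) → ℝ, (∀ a x, 0 < u a x) ∧ (∀ a, DependsOn (u a) (F a)) ∧
    t = fun x => ∏ a, u a x}

/-- Each `a` is assigned to one set `H b` containing `F a`, and the factors assigned to the same `b`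
are multiplied; a `b` that receives none gets the factor 1. -/
theorem factorSet_mono {α β : Type*} [Fintype α] [Fintype β] {F : α → Set (Fin p)}
    {H : β → Set (Fin p)} (h : ∀ a, ∃ b, F a ⊆ H b) : factorSet R F ⊆ factorSet R H := by
  classical
  choose m hm using h
  rintro _ ⟨u, hpos, hdep, rfl⟩
  refine ⟨fun b x => ∏ a with m a = b, u a x, fun b x => Finset.prod_pos fun a _ => hpos a x,
    fun b x y hxy => Finset.prod_congr rfl fun a ha => ?_, ?_⟩
  · obtain rfl := (Finset.mem_filter.1 ha).2
    exact hdep a fun i hi => hxy i (hm a hi)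
  · funext x
    exact (Finset.prod_fiberwise _ _ _).symm

/-- The sets of variables on which `z` and the parameters `q_i` of a DAG depend. -/
def dagFamily (G : Digraph (Fin p)) : Option (Fin p) → Set (Fin p)
  | none => ∅
  | some i => insert i (G.parents i)

/-- The monomial `z ∏_i q_{i; x_i; x_{pa(i)}}`. -/
noncomputable def dagMonomial (R : Fin p → Type*) (G : Digraph (Fin p)) (x : (i : Fin p) → R i) :
    MvPolynomial (Option (CondIndex R G)) ℝ :=
  X none * ∏ i, X (some ⟨i, (x i, fun j => x j)⟩)

open Classical in
/-- An outcome with prescribed values at a vertex and its parents. -/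
noncomputable def condExtend [∀ i, Nonempty (R i)] {G : Digraph (Fin p)} (a : CondIndex R G) :
    (i : Fin p) → R i :=
  Function.update (fun j => if h : j ∈ G.parents a.1 then a.2.2 ⟨j, h⟩ else
    Classical.arbitrary _) a.1 a.2.1

theorem condExtend_self [∀ i, Nonempty (R i)] {G : Digraph (Fin p)} (a : CondIndex R G) :
    condExtend a a.1 = a.2.1 := by
  simp [condExtend]

theorem condExtend_parent [∀ i, Nonempty (R i)] {G : Digraph (Fin p)} (hG : ∀ i, ¬ G.Adj i i)
    (a : CondIndex R G) (j : Fin p) (hj : j ∈ G.parents a.1) :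
    condExtend a j = a.2.2 ⟨j, hj⟩ := by
  have : j ≠ a.1 := by rintro rfl; exact hG _ hj
  rw [condExtend, Function.update_of_ne this, dif_pos hj]

/-- The values of the indeterminates given by functions that factorize according to the DAG. -/
noncomputable def dagPoint [∀ i, Nonempty (R i)] (G : Digraph (Fin p))
    (u : Option (Fin p) → ((i : Fin p) → R i) → ℝ) (a : Option (CondIndex R G)) : ℝ :=
  a.elim (u none (Classical.arbitrary _)) fun a => u (some a.1) (condExtend a)

/-- The arbitrary states in `condExtend` are harmless because `u (some i)` sees only i and its
parents. Thus every factorization, with no sign condition, comes from a point of the parameter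
space. -/
theorem eval_dagMonomial [∀ i, Nonempty (R i)] {G : Digraph (Fin p)} (hG : ∀ i, ¬ G.Adj i i)
    {u : Option (Fin p) → ((i : Fin p) → R i) → ℝ}
    (hdep : ∀ a, DependsOn (u a) (dagFamily G a)) (x : (i : Fin p) → R i) :
    eval (dagPoint G u) (dagMonomial R G x) = ∏ a, u a x := by
  rw [dagMonomial, map_mul, map_prod, eval_X, Fintype.prod_option]
  congr 1
  · exact (hdep none).empty _ _
  · refine Finset.prod_congr rfl fun i _ => ?_
    rw [eval_X]
    refine hdep (some i) fun j hj => ?_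
    obtain rfl | hj := hj
    · exact (condExtend_self (G := G) ⟨j, (x j, fun j => x j)⟩)
    · exact (condExtend_parent hG ⟨i, (x i, fun j => x j)⟩ j hj)

theorem mem_ker_phiCliques_iff [∀ i, Nonempty (R i)] {H : SimpleGraph (Fin p)}
    {f : MvPolynomial ((i : Fin p) → R i) ℝ} :
    f ∈ RingHom.ker (phiCliques R H) ↔
      ∀ t ∈ factorSet R (fun C : MaxClique H => C.1), eval t f = 0 := by
  rw [phiCliques, mem_ker_aeval_iff]
  constructor
  · rintro h _ ⟨u, hpos, hdep, rfl⟩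
    choose g hg using fun C => (dependsOn_iff_exists_comp (f := u C)).1 (hdep C)
    -- Positivity of `u C` passes to `g C` only at restrictions of outcomes, so every clique state
    -- must be seen to be one.
    have hsurj : ∀ (C : MaxClique H) (y : SubState R C.1), ∃ x : (i : Fin p) → R i,
        (C.1.domRestrict x : SubState R C.1) = y := fun C y => by
      classical
      refine ⟨fun j => if h : j ∈ C.1 then y ⟨j, h⟩ else Classical.arbitrary _, ?_⟩
      funext j
      simp [Set.domRestrict]
    have := h (fun a => g a.1 a.2) fun ⟨C, y⟩ => by
      obtain ⟨x, rfl⟩ := hsurj C y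
      have := hpos C x
      rw [hg] at this
      exact this
    convert this using 4 with x
    rw [map_prod]
    exact Finset.prod_congr rfl fun C _ => by rw [eval_X, hg]; rfl
  · intro h w hw
    refine h _ ⟨fun C x => w ⟨C, fun j => x j⟩, fun _ _ => hw _, fun C x y hxy => ?_, ?_⟩
    · exact congrArg w (congrArg (Sigma.mk C) (funext fun j => hxy j j.2))
    · simp [map_prod]

theorem mem_ker_dagMonomial_iff [∀ i, Nonempty (R i)] {G : Digraph (Fin p)}
    (hG : ∀ i, ¬ G.Adj i i) {f : MvPolynomial ((i : Fin p) → R i) ℝ} :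
    f ∈ RingHom.ker (aeval (dagMonomial R G) : _ →ₐ[ℝ] MvPolynomial (Option (CondIndex R G)) ℝ) ↔
      ∀ t ∈ factorSet R (dagFamily G), eval t f = 0 := by
  rw [mem_ker_aeval_iff]
  constructor
  · rintro h _ ⟨u, hpos, hdep, rfl⟩
    have := h (dagPoint G u) fun a => by cases a <;> exact hpos _ _
    convert this using 4 with x
    exact (eval_dagMonomial hG hdep x).symm
  · intro h w hw
    refine h _ ⟨fun a x => a.elim (w none) fun i => w (some ⟨i, (x i, fun j => x j)⟩),
      fun a x => by cases a <;> exact hw _, fun a x y hxy => ?_, ?_⟩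
    · cases a with
      | none => rfl
      | some i =>
        exact congrArg w (congrArg some (congrArg (Sigma.mk i) (Prod.ext
          (hxy i (Or.inl rfl)) (funext fun j => hxy j (Or.inr j.2)))))
    · simp [map_prod, dagMonomial, Fintype.prod_option]

variable [∀ i, Fintype (R i)]

theorem phiDAG_apply (G : Digraph (Fin p)) (f : MvPolynomial ((i : Fin p) → R i) ℝ) :
    phiDAG R G f = Ideal.Quotient.mk (dagIdeal R G) (aeval (dagMonomial R G) f) := by
  have : phiDAG R G = (Ideal.Quotient.mkₐ ℝ (dagIdeal R G)).comp (aeval (dagMonomial R G)) := by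
    ext x
    simp [phiDAG, dagMonomial]
  rw [this]
  rfl

theorem ker_dagMonomial_le (G : Digraph (Fin p)) :
    RingHom.ker (aeval (dagMonomial R G) : _ →ₐ[ℝ] MvPolynomial (Option (CondIndex R G)) ℝ) ≤
      RingHom.ker (phiDAG R G) := by
  intro f hf
  rw [RingHom.mem_ker] at hf ⊢
  rw [phiDAG_apply, hf, map_zero]

/-- Elements of the kernel of `phiDAG` vanish at the probability distributions, up to a constant,
which factorize according to the DAG. -/
theorem eval_eq_zero_of_mem_ker_phiDAG [∀ i, Nonempty (R i)] {G : Digraph (Fin p)}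
    (hG : ∀ i, ¬ G.Adj i i) {f : MvPolynomial ((i : Fin p) → R i) ℝ}
    (hf : f ∈ RingHom.ker (phiDAG R G)) (u : Option (Fin p) → ((i : Fin p) → R i) → ℝ)
    (hdep : ∀ a, DependsOn (u a) (dagFamily G a))
    (hsum : ∀ i x, ∑ s, u (some i) (Function.update x i s) = 1) :
    eval (fun x => ∏ a, u a x) f = 0 := by
  rw [RingHom.mem_ker, phiDAG_apply, Ideal.Quotient.eq_zero_iff_mem] at hf
  have hle : dagIdeal R G ≤ RingHom.ker (eval (dagPoint G u)) := by
    rw [dagIdeal, Ideal.span_le]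
    rintro _ ⟨⟨i, y⟩, rfl⟩
    -- The state chosen here for i is immaterial: the sum in `hsum` overwrites it.
    rw [SetLike.mem_coe, RingHom.mem_ker, map_sub, map_one, map_sum, sub_eq_zero,
      ← hsum i (condExtend (G := G) ⟨i, (Classical.arbitrary _, y)⟩)]
    refine Finset.sum_congr rfl fun s _ => ?_
    rw [eval_X]
    refine hdep (some i) fun j hj => ?_
    obtain rfl | hj := hj
    · rw [Function.update_self]
      exact (condExtend_self (G := G) ⟨j, (s, y)⟩).symm
    · have : j ≠ i := by rintro rfl; exact hG _ hj
      rw [Function.update_of_ne this]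
      exact (condExtend_parent hG ⟨i, (_, y)⟩ j hj).trans
        (condExtend_parent hG ⟨i, (s, y)⟩ j hj).symm
  have := eval_eq_zero_of_aeval_eq_zero _ (hle hf)
  convert this using 4 with x
  exact (eval_dagMonomial hG hdep x).symm

end Factor

/-! ### Perfect DAGs -/

section Perfect

variable {p : ℕ} {R : Fin p → Type*} {G : Digraph (Fin p)} {π : Equiv.Perm (Fin p)}

theorem Digraph.IsLinearExtension.not_adj_self (hπ : G.IsLinearExtension π) (i : Fin p) :
    ¬ G.Adj i i :=
  fun h => lt_irrefl _ (hπ i i h)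

theorem SimpleGraph.IsClique.exists_maxClique {V : Type*} [Finite V] {H : SimpleGraph V}
    {s : Set V} (hs : H.IsClique s) : ∃ C : MaxClique H, s ⊆ C.1 := by
  obtain ⟨C, hsC, hC⟩ := Set.Finite.exists_le_maximal (Set.toFinite {s | H.IsClique s}) hs
  exact ⟨⟨C, hC⟩, hsC⟩

theorem Digraph.IsPerfectDAG.isClique_dagFamily (h : G.IsPerfectDAG) (a : Option (Fin p)) :
    G.skeleton.IsClique (dagFamily G a) := by
  cases a with
  | none => exact SimpleGraph.isClique_empty
  | some i =>
    intro j hj k hk hjk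
    refine ⟨hjk, ?_⟩
    obtain rfl | hj := hj
    · obtain rfl | hk := hk
      · exact absurd rfl hjk
      · exact Or.inr hk
    · obtain rfl | hk := hk
      · exact Or.inl hj
      · exact h i j hj k hk hjk

/-- Take the member of the clique that comes last in `π`: the others are adjacent to it and earlier,
hence its parents. The empty clique goes to `none`, the slot of z. That i lies in `s` is recorded
for `exists_normalized`, where the absorbing vertex has to be a parent. -/
theorem Digraph.IsLinearExtension.exists_subset_dagFamily (hπ : G.IsLinearExtension π)
    {s : Set (Fin p)} (hs : G.skeleton.IsClique s) :
    ∃ a, s ⊆ dagFamily G a ∧ ∀ i ∈ a, i ∈ s := by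
  obtain rfl | hne := s.eq_empty_or_nonempty
  · exact ⟨none, Set.empty_subset _, by simp⟩
  · obtain ⟨i, hi, hmax⟩ := s.exists_max_image π.symm (Set.toFinite _) hne
    refine ⟨some i, fun j hj => ?_, by simpa using hi⟩
    by_cases hji : j = i
    · exact Or.inl hji
    · obtain ⟨-, h | h⟩ := hs hj hi hji
      · exact Or.inr h
      · exact absurd (hπ _ _ h) (hmax j hj).not_gt

theorem Digraph.IsPerfectDAG.factorSet_eq (h : G.IsPerfectDAG) (hπ : G.IsLinearExtension π) :
    factorSet R (dagFamily G) = factorSet R (fun C : MaxClique G.skeleton => C.1) :=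
  (factorSet_mono fun a => (h.isClique_dagFamily a).exists_maxClique).antisymm
    (factorSet_mono fun C => (hπ.exists_subset_dagFamily C.2.1).imp fun _ h => h.1)

theorem Digraph.IsPerfectDAG.ker_dagMonomial_eq_ker_phiCliques [∀ i, Nonempty (R i)]
    (h : G.IsPerfectDAG) (hπ : G.IsLinearExtension π) :
    RingHom.ker (aeval (dagMonomial R G) : _ →ₐ[ℝ] MvPolynomial (Option (CondIndex R G)) ℝ) =
      RingHom.ker (phiCliques R G.skeleton) := by
  ext f
  rw [mem_ker_dagMonomial_iff hπ.not_adj_self, mem_ker_phiCliques_iff, h.factorSet_eq hπ]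

variable [∀ i, Fintype (R i)]

/-- For a perfect DAG, the conditional factors can be normalized, starting with the last vertex:
the normalizing constant of a vertex is absorbed by the factor of its last parent. -/
theorem Digraph.IsPerfectDAG.exists_normalized [∀ i, Nonempty (R i)] (h : G.IsPerfectDAG)
    (hπ : G.IsLinearExtension π) (u : Option (Fin p) → ((i : Fin p) → R i) → ℝ)
    (hpos : ∀ a x, 0 < u a x) (hdep : ∀ a, DependsOn (u a) (dagFamily G a))
    (n : ℕ) (hn : n ≤ p) :
    ∃ v : Option (Fin p) → ((i : Fin p) → R i) → ℝ, (∀ a x, 0 < v a x) ∧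
      (∀ a, DependsOn (v a) (dagFamily G a)) ∧ (∀ x, ∏ a, v a x = ∏ a, u a x) ∧
      ∀ i, n ≤ π.symm i → ∀ x, ∑ s, v (some i) (Function.update x i s) = 1 := by
  induction hn using Nat.decreasingInduction with
  | self => exact ⟨u, hpos, hdep, fun _ => rfl, fun i hi => absurd (π.symm i).2 hi.not_gt⟩
  | of_succ n hn ih =>
    obtain ⟨v, vpos, vdep, vprod, vsum⟩ := ih
    obtain ⟨i, hi⟩ : ∃ i, (π.symm i : ℕ) = n := ⟨π ⟨n, hn⟩, by simp⟩
    have hpar : G.skeleton.IsClique (G.parents i) := fun j hj k hk hjk =>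
      ⟨hjk, h i j hj k hk hjk⟩
    -- `b` is the last parent of `i`, or the slot of z if `i` has no parents. It precedes `i`, so
    -- the factors normalized so far are not disturbed.
    obtain ⟨b, hb, hbi⟩ := hπ.exists_subset_dagFamily hpar
    have hlt : ∀ j ∈ b, (π.symm j : ℕ) < n := fun j hj => hi ▸ hπ _ _ (hbi j hj)
    have hbi : b ≠ some i := by
      rintro rfl
      have := hlt i rfl
      omega
    set c : ((i : Fin p) → R i) → ℝ := fun x => ∑ s, v (some i) (Function.update x i s)
    have cpos : ∀ x, 0 < c x := fun x =>
      Finset.sum_pos (fun s _ => vpos _ _) Finset.univ_nonempty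
    have cdep : DependsOn c (G.parents i) := fun x y hxy =>
      Finset.sum_congr rfl fun s _ => vdep (some i) fun j hj => by
        by_cases hji : j = i
        · subst hji; simp
        · rw [Function.update_of_ne hji, Function.update_of_ne hji]
          exact hxy j (hj.resolve_left hji)
    have cupd : ∀ x s, c (Function.update x i s) = c x := fun x s => by simp [c]
    -- The sum `c` is divided out of the factor of `i` and multiplied into that of `b`, which may
    -- depend on all parents of `i` since these form a clique.
    refine ⟨fun a x => (if a = b then c x else 1) * (if a = some i then (c x)⁻¹ else 1) * v a x,
      fun a x => ?_, fun a => ?_, fun x => ?_, fun k hk x => ?_⟩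
    · have := cpos x
      have := vpos a x
      dsimp only
      split_ifs <;> positivity
    · refine (DependsOn.mul ?_ ?_).mul (vdep a)
      · split_ifs with ha
        · exact ha ▸ cdep.mono hb
        · exact fun _ _ _ => rfl
      · split_ifs with ha
        · subst ha
          exact fun x y hxy => congrArg _ (cdep fun j hj => hxy j (Or.inr hj))
        · exact fun _ _ _ => rfl
    · rw [Finset.prod_mul_distrib, Finset.prod_mul_distrib, Fintype.prod_ite_eq',
        Fintype.prod_ite_eq', mul_inv_cancel₀ (cpos x).ne', one_mul, vprod]
    · have hkb : some k ≠ b := by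
        rintro rfl
        have := hlt k rfl
        omega
      simp only [if_neg hkb, one_mul]
      by_cases hki : k = i
      · subst hki
        simp only [if_true, cupd]
        rw [← Finset.mul_sum]
        exact inv_mul_cancel₀ (cpos x).ne'
      · have : π.symm k ≠ π.symm i := fun e => hki (π.symm.injective e)
        have : (π.symm k : ℕ) ≠ π.symm i := fun e => this (Fin.ext e)
        simp only [Option.some.injEq, if_neg hki, one_mul]
        exact vsum k (by omega) x

theorem Digraph.IsPerfectDAG.ker_dagMonomial_eq [∀ i, Nonempty (R i)] (h : G.IsPerfectDAG)
    (hπ : G.IsLinearExtension π) :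
    RingHom.ker (aeval (dagMonomial R G) : _ →ₐ[ℝ] MvPolynomial (Option (CondIndex R G)) ℝ) =
      RingHom.ker (phiDAG R G) := by
  refine (ker_dagMonomial_le G).antisymm fun f hf => ?_
  rw [mem_ker_dagMonomial_iff hπ.not_adj_self]
  rintro _ ⟨u, hpos, hdep, rfl⟩
  obtain ⟨v, -, vdep, vprod, vsum⟩ := h.exists_normalized hπ u hpos hdep 0 (Nat.zero_le p)
  simp only [← vprod]
  exact eval_eq_zero_of_mem_ker_phiDAG hπ.not_adj_self hf v vdep
    fun i x => vsum i (Nat.zero_le _) x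

end Perfect

/-! ### The polynomial of a conditional independence statement -/

section Nonperfect

variable {p : ℕ} {R : Fin p → Type*} {G : Digraph (Fin p)}
  {π : Equiv.Perm (Fin p)}

theorem filter_symm_lt_succ (π : Equiv.Perm (Fin p)) (i : Fin p) :
    (Finset.univ.filter fun l => (π.symm l : ℕ) < π.symm i + 1) =
      insert i (Finset.univ.filter fun l => (π.symm l : ℕ) < π.symm i) := by
  ext l
  have : (π.symm l : ℕ) = π.symm i ↔ l = i :=
    ⟨fun h => π.symm.injective (Fin.ext h), fun h => h ▸ rfl⟩
  simp only [Finset.mem_filter, Finset.mem_univ, true_and, Finset.mem_insert, ← this]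
  omega

/-- Neither `l` nor a parent of `l` can be the later vertex `i`, so factors before `i` do not see
its state. -/
theorem condIndex_update_of_lt (hπ : G.IsLinearExtension π) {l i : Fin p}
    (hl : π.symm l < π.symm i) (x : (i : Fin p) → R i) (s : R i) :
    (⟨l, (Function.update x i s l, fun j => Function.update x i s j)⟩ : CondIndex R G) =
      ⟨l, (x l, fun j => x j)⟩ := by
  have hli : l ≠ i := by rintro rfl; exact lt_irrefl _ hl
  rw [Function.update_of_ne hli]
  congr 2
  funext j
  refine Function.update_of_ne ?_ _ _
  intro hj
  have := hπ _ _ j.2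
  rw [hj] at this
  exact lt_asymm hl this

theorem condIndex_update_self (hπ : G.IsLinearExtension π) (i : Fin p)
    (x : (i : Fin p) → R i) (s : R i) :
    (⟨i, (Function.update x i s i, fun j => Function.update x i s j)⟩ : CondIndex R G) =
      ⟨i, (s, fun j => x j)⟩ := by
  rw [Function.update_self]
  congr 2
  funext j
  refine Function.update_of_ne ?_ _ _
  intro hj
  have := hπ _ _ j.2
  rw [hj] at this
  exact lt_irrefl _ this

open Classical in
/-- The indicator function of a set of two outcomes. -/
noncomputable def pairIndicator (x y t : (i : Fin p) → R i) : ℝ := if t = x ∨ t = y then 1 else 0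

open Classical in
/-- If the set of variables in which `x` and `y` differ consists of `k` and of variables which lie
in a common member of the family with `k`, then the indicator function of `{x, y}` factorizes. -/
theorem pairIndicator_eq_prod {α : Type*} [Fintype α] {F : α → Set (Fin p)}
    {x y : (i : Fin p) → R i} {k : Fin p} (hcover : ∀ l, ∃ a, l ∈ F a)
    (hk : ∀ l, x l ≠ y l → ∃ a, l ∈ F a ∧ k ∈ F a) (hxy : x k ≠ y k) :
    pairIndicator x y =
      fun t => ∏ a, if (∀ l ∈ F a, t l = x l) ∨ (∀ l ∈ F a, t l = y l) then (1 : ℝ) else 0 := by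
  funext t
  rw [Finset.prod_ite_zero, pairIndicator]
  simp only [Finset.prod_const_one, Finset.mem_univ, true_implies]
  congr 1
  refine propext ⟨?_, fun h => ?_⟩
  · rintro (rfl | rfl) a
    · exact Or.inl fun _ _ => rfl
    · exact Or.inr fun _ _ => rfl
  · have hsame : ∀ l, x l = y l → t l = x l := fun l hl => by
      obtain ⟨a, ha⟩ := hcover l
      obtain h | h := h a
      · exact h l ha
      · rw [hl]; exact h l ha
    obtain ⟨a, ha⟩ := hcover k
    obtain htk | htk : t k = x k ∨ t k = y k := (h a).imp (fun h => h k ha) fun h => h k ha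
    · refine Or.inl (funext fun l => ?_)
      by_cases hl : x l = y l
      · exact hsame l hl
      · obtain ⟨a, hla, hka⟩ := hk l hl
        obtain h | h := h a
        · exact h l hla
        · exact absurd (htk.symm.trans (h k hka)) hxy
    · refine Or.inr (funext fun l => ?_)
      by_cases hl : x l = y l
      · exact (hsame l hl).trans hl
      · obtain ⟨a, hla, hka⟩ := hk l hl
        obtain h | h := h a
        · exact absurd ((h k hka).symm.trans htk) hxy
        · exact h l hla

variable [∀ i, Fintype (R i)]

open Classical in
/-- The marginal of an outcome of the first `n` variables. -/
noncomputable def marginal (R : Fin p → Type*) [∀ i, Fintype (R i)] (π : Equiv.Perm (Fin p))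
    (n : ℕ) (y : (i : Fin p) → R i) : MvPolynomial ((i : Fin p) → R i) ℝ :=
  ∑ x with ∀ l, (π.symm l : ℕ) < n → x l = y l, X x

theorem marginal_last (y : (i : Fin p) → R i) : marginal R π p y = X y := by
  classical
  rw [marginal, Finset.sum_eq_single y]
  · intro x hx hxy
    exact absurd (funext fun l => (Finset.mem_filter.1 hx).2 l (π.symm l).2) hxy
  · intro h
    simp at h

theorem marginal_succ (i : Fin p) (y : (i : Fin p) → R i) :
    marginal R π (π.symm i) y =
      ∑ s, marginal R π (π.symm i + 1) (Function.update y i s) := by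
  classical
  simp only [marginal]
  rw [← Finset.sum_fiberwise _ (fun x => x i)]
  refine Finset.sum_congr rfl fun s _ => Finset.sum_congr ?_ fun _ _ => rfl
  ext x
  simp only [Finset.mem_filter, Finset.mem_univ, true_and]
  constructor
  · rintro ⟨h, rfl⟩ l hl
    by_cases hli : l = i
    · subst hli; simp
    · rw [Function.update_of_ne hli]
      have : π.symm l ≠ π.symm i := fun e => hli (π.symm.injective e)
      have : (π.symm l : ℕ) ≠ π.symm i := fun e => this (Fin.ext e)
      exact h l (by omega)
  · intro h
    refine ⟨fun l hl => ?_, by simpa using h i (by omega)⟩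
    have hli : l ≠ i := by rintro rfl; omega
    simpa [hli] using h l (by omega)

open Classical in
theorem phiDAG_marginal (hπ : G.IsLinearExtension π) (n : ℕ) (hn : n ≤ p) :
    ∀ y : (i : Fin p) → R i, phiDAG R G (marginal R π n y) = Ideal.Quotient.mk (dagIdeal R G)
      (X none * ∏ i with (π.symm i : ℕ) < n, X (some ⟨i, (y i, fun j => y j)⟩)) := by
  induction hn using Nat.decreasingInduction with
  | self =>
    intro y
    rw [marginal_last, phiDAG, aeval_X]
    simp
  | of_succ n hn ih =>
    intro y
    obtain ⟨i, rfl⟩ : ∃ i, (π.symm i : ℕ) = n := ⟨π ⟨n, hn⟩, by simp⟩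
    have hone : Ideal.Quotient.mk (dagIdeal R G)
        (∑ s, X (some (⟨i, (s, fun j => y j)⟩ : CondIndex R G))) = 1 := by
      rw [← map_one (Ideal.Quotient.mk (dagIdeal R G)), eq_comm, Ideal.Quotient.eq]
      exact Ideal.subset_span ⟨⟨i, fun j => y j⟩, rfl⟩
    rw [marginal_succ, map_sum]
    simp only [ih]
    rw [← mul_one (Ideal.Quotient.mk (dagIdeal R G) _), ← hone, ← map_mul, Finset.mul_sum,
      map_sum]
    refine Finset.sum_congr rfl fun s _ => congrArg _ ?_
    rw [filter_symm_lt_succ, Finset.prod_insert (by simp), mul_assoc]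
    congr 1
    rw [mul_comm]
    congr 1
    · refine Finset.prod_congr rfl fun l hl => ?_
      rw [condIndex_update_of_lt hπ (Finset.mem_filter.1 hl).2]
    · rw [condIndex_update_self hπ]

/-- The polynomial expressing that `X_i` is independent of the variables before it which are
not its parents, given its parents. -/
noncomputable def ciPoly (R : Fin p → Type*) [∀ i, Fintype (R i)] (π : Equiv.Perm (Fin p))
    (i : Fin p) (x y : (i : Fin p) → R i) : MvPolynomial ((i : Fin p) → R i) ℝ :=
  marginal R π (π.symm i + 1) x * marginal R π (π.symm i + 1) y -
    marginal R π (π.symm i + 1) (Function.update x i (y i)) *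
      marginal R π (π.symm i + 1) (Function.update y i (x i))

theorem ciPoly_mem_ker_phiDAG (hπ : G.IsLinearExtension π) (i : Fin p)
    (x y : (i : Fin p) → R i) (h : ∀ j ∈ G.parents i, x j = y j) :
    ciPoly R π i x y ∈ RingHom.ker (phiDAG R G) := by
  classical
  have hlow : ∀ (x : (i : Fin p) → R i) (s : R i),
      ∏ l with (π.symm l : ℕ) < π.symm i, (X (some ⟨l, (Function.update x i s l,
        fun j => Function.update x i s j)⟩) : MvPolynomial (Option (CondIndex R G)) ℝ) =
      ∏ l with (π.symm l : ℕ) < π.symm i, X (some ⟨l, (x l, fun j => x j)⟩) := by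
    refine fun x s => Finset.prod_congr rfl fun l hl => ?_
    rw [condIndex_update_of_lt hπ (Finset.mem_filter.1 hl).2]
  have hpar : (fun j : G.parents i => x j) = fun j : G.parents i => y j :=
    funext fun j => h j j.2
  rw [RingHom.mem_ker, ciPoly, map_sub, map_mul, map_mul]
  simp only [phiDAG_marginal hπ _ (π.symm i).2, ← map_mul, ← map_sub]
  rw [filter_symm_lt_succ]
  simp only [Finset.prod_insert (show i ∉ Finset.univ.filter fun l =>
    (π.symm l : ℕ) < π.symm i by simp), hlow, condIndex_update_self hπ, hpar]
  rw [← map_zero (Ideal.Quotient.mk (dagIdeal R G))]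
  congr 1
  ring

theorem eval_pairIndicator_marginal {x y t z : (i : Fin p) → R i} {n : ℕ} (h : t = x ∨ t = y)
    (hz : ∀ l, (π.symm l : ℕ) < n → t l = z l) (hne : ∃ l, (π.symm l : ℕ) < n ∧ x l ≠ y l) :
    eval (pairIndicator x y) (marginal R π n z) = 1 := by
  classical
  rw [marginal, map_sum, Finset.sum_eq_single t]
  · rw [eval_X, pairIndicator, if_pos h]
  · intro t' ht' hne'
    rw [eval_X, pairIndicator, if_neg]
    have ht' := (Finset.mem_filter.1 ht').2
    obtain ⟨l, hl, hxy⟩ := hne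
    have := (hz l hl).trans (ht' l hl).symm
    rintro (rfl | rfl) <;> rcases h with rfl | rfl <;> simp_all
  · intro h
    exact absurd (Finset.mem_filter.2 ⟨Finset.mem_univ _, hz⟩) h

theorem eval_pairIndicator_marginal_eq_zero {x y z : (i : Fin p) → R i} {n : ℕ}
    (hx : ∃ l, (π.symm l : ℕ) < n ∧ x l ≠ z l) (hy : ∃ l, (π.symm l : ℕ) < n ∧ y l ≠ z l) :
    eval (pairIndicator x y) (marginal R π n z) = 0 := by
  classical
  rw [marginal, map_sum]
  refine Finset.sum_eq_zero fun t ht => ?_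
  rw [eval_X, pairIndicator, if_neg]
  have ht := (Finset.mem_filter.1 ht).2
  rintro (rfl | rfl)
  · obtain ⟨l, hl, h⟩ := hx
    exact h (ht l hl)
  · obtain ⟨l, hl, h⟩ := hy
    exact h (ht l hl)

theorem eval_pairIndicator_ciPoly {x y : (i : Fin p) → R i} {i j : Fin p}
    (hij : π.symm j < π.symm i) (hi : x i ≠ y i) (hj : x j ≠ y j) :
    eval (pairIndicator x y) (ciPoly R π i x y) = 1 := by
  have hji : j ≠ i := by rintro rfl; exact lt_irrefl _ hij
  have hij' : (π.symm j : ℕ) < π.symm i + 1 := Nat.lt_succ_of_lt hij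
  have hi' : (π.symm i : ℕ) < π.symm i + 1 := Nat.lt_succ_self _
  rw [ciPoly, map_sub, map_mul, map_mul,
    eval_pairIndicator_marginal (Or.inl rfl) (fun _ _ => rfl) ⟨i, hi', hi⟩,
    eval_pairIndicator_marginal (Or.inr rfl) (fun _ _ => rfl) ⟨i, hi', hi⟩,
    eval_pairIndicator_marginal_eq_zero ⟨i, hi', by simpa⟩
      ⟨j, hij', by simpa [hji] using hj.symm⟩]
  simp

theorem exists_ciPoly_of_not_isPerfectDAG [∀ i, Nontrivial (R i)] (hπ : G.IsLinearExtension π)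
    (h : ¬ G.IsPerfectDAG) : ∃ f ∈ RingHom.ker (phiDAG R G),
      f ∉ RingHom.ker (phiCliques R G.skeleton) ∧
      f ∉ RingHom.ker
        (aeval (dagMonomial R G) : _ →ₐ[ℝ] MvPolynomial (Option (CondIndex R G)) ℝ) := by
  classical
  obtain ⟨k, i, hi, j, hj, hij, hnij, hnji⟩ : ∃ k, ∃ i ∈ G.parents k, ∃ j ∈ G.parents k,
      π.symm j < π.symm i ∧ ¬ G.Adj i j ∧ ¬ G.Adj j i := by
    simp only [Digraph.IsPerfectDAG] at h
    push Not at h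
    obtain ⟨k, i, hi, j, hj, hne, h1, h2⟩ := h
    obtain hlt | hlt := lt_or_gt_of_ne (π.symm.injective.ne hne)
    · exact ⟨k, j, hj, i, hi, hlt, h2, h1⟩
    · exact ⟨k, i, hi, j, hj, hlt, h1, h2⟩
  obtain ⟨x⟩ : Nonempty ((i : Fin p) → R i) := inferInstance
  choose b hb using fun l => exists_ne (x l)
  set y : (i : Fin p) → R i := fun l => if l = i ∨ l = j ∨ l = k then b l else x l with hy
  have hxy : ∀ l, x l ≠ y l → l = i ∨ l = j ∨ l = k := by
    intro l hl
    by_contra hc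
    exact hl (by rw [hy]; simp [hc])
  have hxi : x i ≠ y i := by simpa [hy] using (hb i).symm
  have hxj : x j ≠ y j := by simpa [hy] using (hb j).symm
  have hxk : x k ≠ y k := by simpa [hy] using (hb k).symm
  have hev := eval_pairIndicator_ciPoly (π := π) hij hxi hxj
  refine ⟨ciPoly R π i x y, ciPoly_mem_ker_phiDAG hπ i x y fun l hl => ?_, fun hf => ?_,
    fun hf => ?_⟩
  · by_contra hne
    obtain rfl | rfl | rfl := hxy l hne
    · exact hπ.not_adj_self _ hl
    · exact hnji hl
    · exact lt_asymm (hπ _ _ hi) (hπ _ _ hl)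
  · have hzero := eval_eq_zero_of_aeval_eq_zero (fun a : (C : MaxClique G.skeleton) ×
      SubState R C.1 => if (∀ l (hl : l ∈ a.1.1), a.2 ⟨l, hl⟩ = x l) ∨
        (∀ l (hl : l ∈ a.1.1), a.2 ⟨l, hl⟩ = y l) then (1 : ℝ) else 0)
      (show eval _ (phiCliques R G.skeleton (ciPoly R π i x y)) = 0 by
        rw [RingHom.mem_ker.1 hf, map_zero])
    rw [pairIndicator_eq_prod (F := fun C : MaxClique G.skeleton => C.1) (k := k)
      (fun l => ?_) (fun l hl => ?_) hxk] at hev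
    · simp only [map_prod, eval_X] at hzero
      exact one_ne_zero (hev.symm.trans hzero)
    · exact (SimpleGraph.isClique_singleton (G := G.skeleton) l).exists_maxClique.imp
        fun C hC => hC rfl
    · have hcl : G.skeleton.IsClique {l, k} := by
        refine SimpleGraph.isClique_pair.2 fun hlk => ⟨hlk, Or.inl ?_⟩
        obtain rfl | rfl | rfl := hxy l hl
        · exact hi
        · exact hj
        · exact absurd rfl hlk
      exact hcl.exists_maxClique.imp fun C hC => ⟨hC (Or.inl rfl), hC (Or.inr rfl)⟩
  · have hdep : ∀ a, DependsOn (fun t : (i : Fin p) → R i =>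
        if (∀ l ∈ dagFamily G a, t l = x l) ∨ (∀ l ∈ dagFamily G a, t l = y l)
        then (1 : ℝ) else 0) (dagFamily G a) := by
      intro a t t' h
      have (z : (i : Fin p) → R i) : (∀ l ∈ dagFamily G a, t l = z l) ↔
          ∀ l ∈ dagFamily G a, t' l = z l :=
        forall₂_congr fun l hl => by rw [h l hl]
      simp only [this]
    have hzero := eval_eq_zero_of_aeval_eq_zero (dagPoint G fun a t =>
        if (∀ l ∈ dagFamily G a, t l = x l) ∨ (∀ l ∈ dagFamily G a, t l = y l)
        then (1 : ℝ) else 0)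
      (show eval _ (aeval (dagMonomial R G) (ciPoly R π i x y)) = 0 by
        rw [RingHom.mem_ker.1 hf, map_zero])
    rw [pairIndicator_eq_prod (F := dagFamily G) (k := k)
      (fun l => ⟨some l, Or.inl rfl⟩) (fun l hl => ⟨some k, ?_, Or.inl rfl⟩) hxk] at hev
    · simp only [eval_dagMonomial hπ.not_adj_self hdep] at hzero
      exact one_ne_zero (hev.symm.trans hzero)
    · obtain rfl | rfl | rfl := hxy l hl
      · exact Or.inr hi
      · exact Or.inr hj
      · exact Or.inl rfl

end Nonperfect

/-! ### The staged tree of a DAG -/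

theorem StagedTree.mem_outEdges {V L : Type*} [Finite V] {T : StagedTree V L} {v : V}
    {e : T.Edge} : e ∈ T.outEdges v ↔ e.1.1 = v := by
  simp [StagedTree.outEdges]

section Tree

variable {p : ℕ} {R : Fin p → Type*} {G : Digraph (Fin p)} {π : Equiv.Perm (Fin p)}

/-- The outcome of the first `k` variables given by an outcome of all variables. -/
def outcomePrefix (π : Equiv.Perm (Fin p)) (x : (i : Fin p) → R i) (k : Fin (p + 1)) :
    DAGTreeVertex R π :=
  ⟨k, fun i => x i⟩

/-- The edge at the variable `i` of the path from the root to the leaf `x`. -/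
def pathEdge (π : Equiv.Perm (Fin p)) (x : (i : Fin p) → R i) (i : Fin p) :
    {e : DAGTreeVertex R π × DAGTreeVertex R π // (dagTreeGraph R π).Adj e.1 e.2} :=
  ⟨(outcomePrefix π x (π.symm i).castSucc, outcomePrefix π x (π.symm i).succ),
    by simp [outcomePrefix], fun _ _ _ => rfl⟩

theorem edgeVar_eq_of_level_eq
    {e : {e : DAGTreeVertex R π × DAGTreeVertex R π // (dagTreeGraph R π).Adj e.1 e.2}} {i : Fin p}
    (h : (e.1.1.1 : ℕ) = π.symm i) : edgeVar e = i :=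
  π.symm.injective (Fin.ext ((symm_edgeVar e).trans h))

theorem pathEdge_injective (x : (i : Fin p) → R i) : Function.Injective (pathEdge π x) := by
  intro i j h
  rw [← edgeVar_eq_of_level_eq (e := pathEdge π x i) rfl, h, edgeVar_eq_of_level_eq rfl]

theorem dagTreeLabel_pathEdge (hπ : G.IsLinearExtension π) (x : (i : Fin p) → R i) (i : Fin p) :
    dagTreeLabel G hπ (pathEdge π x i) = ⟨i, (x i, fun j => x j)⟩ :=
  dagTreeLabel_eq G hπ _ i (edgeVar_eq_of_level_eq rfl) (Nat.lt_succ_self _) fun j hj => hπ j i hj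

theorem dagTreeGraph_reflTransGen {a b : DAGTreeVertex R π}
    (h : Relation.ReflTransGen (dagTreeGraph R π).Adj a b) :
    (a.1 : ℕ) ≤ b.1 ∧ ∀ (i : Fin p) (ha : (π.symm i : ℕ) < a.1) (hb : (π.symm i : ℕ) < b.1),
      b.2 ⟨i, hb⟩ = a.2 ⟨i, ha⟩ := by
  induction h with
  | refl => exact ⟨le_rfl, fun _ _ _ => rfl⟩
  | tail _ hadj ih =>
    have h1 := hadj.1
    exact ⟨by omega, fun i ha hb => by rw [hadj.2 i (by omega) hb, ih.2 i ha]⟩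

theorem reflTransGen_outcomePrefix (x : (i : Fin p) → R i) (k : ℕ) (hk : k ≤ p) :
    Relation.ReflTransGen (dagTreeGraph R π).Adj (outcomePrefix π x ⟨k, Nat.lt_succ_of_le hk⟩)
      (outcomePrefix π x (Fin.last p)) := by
  induction hk using Nat.decreasingInduction with
  | self => exact .refl
  | of_succ k hk ih =>
    have hadj : (dagTreeGraph R π).Adj (outcomePrefix π x ⟨k, by omega⟩)
        (outcomePrefix π x ⟨k + 1, by omega⟩) := ⟨rfl, fun _ _ _ => rfl⟩
    exact .head hadj ih

variable [∀ i, Fintype (R i)]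

open Classical in
theorem image_label_outEdges (hπ : G.IsLinearExtension π) (x : (i : Fin p) → R i) (i : Fin p) :
    ((dagTree R G hπ).outEdges (outcomePrefix π x (π.symm i).castSucc)).image
      (dagTree R G hπ).label = Finset.univ.image fun s => ⟨i, (s, fun j => x j)⟩ := by
  ext a
  simp only [Finset.mem_image, StagedTree.mem_outEdges, Finset.mem_univ, true_and]
  constructor
  · rintro ⟨⟨⟨v, w⟩, hvw⟩, rfl, rfl⟩
    have h1 : (w.1 : ℕ) = π.symm i + 1 := hvw.1
    have hi : (π.symm i : ℕ) < w.1 := h1 ▸ Nat.lt_succ_self _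
    exact ⟨w.2 ⟨i, hi⟩, (dagTreeLabel_eq G hπ ⟨(_, w), hvw⟩ i (edgeVar_eq_of_level_eq rfl) hi
      fun j hj => hπ j i hj).symm⟩
  · rintro ⟨s, rfl⟩
    have hadj : (dagTreeGraph R π).Adj (outcomePrefix π x (π.symm i).castSucc)
        (outcomePrefix π (Function.update x i s) (π.symm i).succ) := by
      refine ⟨rfl, fun j hj _ => Function.update_of_ne (fun h => ?_) _ _⟩
      obtain rfl : j = i := h
      exact lt_irrefl _ hj
    refine ⟨⟨(_, _), hadj⟩, rfl, ?_⟩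
    refine (dagTreeLabel_eq G hπ ⟨(_, _), hadj⟩ i (edgeVar_eq_of_level_eq rfl) (Nat.lt_succ_self _)
      fun j hj => hπ j i hj).trans ?_
    simp

theorem sum_outEdges (hπ : G.IsLinearExtension π) (x : (i : Fin p) → R i) (i : Fin p) :
    (∑ e ∈ (dagTree R G hπ).outEdges (outcomePrefix π x (π.symm i).castSucc),
      X (some ((dagTree R G hπ).label e)) : MvPolynomial (Option (CondIndex R G)) ℝ) =
      ∑ s : R i, X (some ⟨i, (s, fun j => x j)⟩) := by
  classical
  have hinj : Set.InjOn (dagTree R G hπ).label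
      ((dagTree R G hπ).outEdges (outcomePrefix π x (π.symm i).castSucc)) :=
    fun e he e' he' h => (dagTree R G hπ).label_injOn (outcomePrefix π x (π.symm i).castSucc)
      (StagedTree.mem_outEdges.1 he) (StagedTree.mem_outEdges.1 he') h
  rw [← Finset.sum_image (f := fun a => X (some a)) hinj, image_label_outEdges, Finset.sum_image]
  intro s _ t _ h
  exact congrArg Prod.fst (eq_of_heq (Sigma.mk.inj h).2)

variable [∀ i, Nonempty (R i)]

theorem rootPath_dagTreeLeaf (hπ : G.IsLinearExtension π) (x : (i : Fin p) → R i) :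
    (dagTree R G hπ).rootPath (dagTreeLeaf R G hπ x).1 =
      Finset.univ.map ⟨pathEdge π x, pathEdge_injective x⟩ := by
  ext e
  classical
  refine (Finset.mem_filter_univ _).trans (Iff.trans ?_ Finset.mem_map.symm)
  constructor
  · intro h
    have hx := (dagTreeGraph_reflTransGen h).2
    have hadj := e.2
    have h1 := hadj.1
    have hs := symm_edgeVar e
    refine ⟨edgeVar e, Finset.mem_univ _, Subtype.ext (Prod.ext (DAGTreeVertex.ext' hs fun i ha hb => ?_)
      (DAGTreeVertex.ext' (by rw [h1, ← hs]; rfl) fun i ha hb => ?_))⟩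
    · rw [← hadj.2 i hb (by omega)]
      exact hx i (by omega) (π.symm i).2
    · exact hx i hb (π.symm i).2
  · rintro ⟨i, -, rfl⟩
    exact reflTransGen_outcomePrefix x (π.symm i + 1) (π.symm i).2

theorem rootPath_monomial (hπ : G.IsLinearExtension π) (x : (i : Fin p) → R i) :
    (X none * ∏ e ∈ (dagTree R G hπ).rootPath (dagTreeLeaf R G hπ x).1,
      X (some ((dagTree R G hπ).label e)) : MvPolynomial (Option (CondIndex R G)) ℝ) =
      dagMonomial R G x := by
  rw [rootPath_dagTreeLeaf]
  refine congrArg (X none * ·) ((Finset.prod_map _ _ _).trans ?_)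
  exact Finset.prod_congr rfl fun i _ => congrArg (fun a => X (some a))
    (dagTreeLabel_pathEdge hπ x i)

theorem psiToric_dagTree (hπ : G.IsLinearExtension π) :
    (dagTree R G hπ).psiToric (dagTreeLeaf R G hπ) = aeval (dagMonomial R G) := by
  unfold StagedTree.psiToric
  simp only [rootPath_monomial]

theorem stageIdeal_dagTree (hπ : G.IsLinearExtension π) :
    (dagTree R G hπ).stageIdeal = dagIdeal R G := by
  classical
  unfold StagedTree.stageIdeal dagIdeal
  congr 1
  ext f
  constructor
  · rintro ⟨v, hv, rfl⟩
    rw [dagTree_isLeaf_iff] at hv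
    have hlt : (v.1 : ℕ) < p := by have := v.1.2; omega
    set x : (i : Fin p) → R i := fun i =>
      if h : (π.symm i : ℕ) < v.1 then v.2 ⟨i, h⟩ else Classical.arbitrary _ with hx
    have hvx : v = outcomePrefix π x (π.symm (π ⟨v.1, hlt⟩)).castSucc :=
      DAGTreeVertex.ext' (by simp [outcomePrefix]) fun i ha hb => by
        simp only [outcomePrefix, hx, dif_pos ha]
    refine ⟨⟨π ⟨v.1, hlt⟩, fun j => x j⟩, ?_⟩
    dsimp only
    rw [← sum_outEdges hπ x, ← hvx]
  · rintro ⟨⟨i, y⟩, rfl⟩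
    set x : (i : Fin p) → R i := fun j =>
      if h : j ∈ G.parents i then y ⟨j, h⟩ else Classical.arbitrary _ with hx
    have hy : y = fun j : G.parents i => x j := by
      funext j
      simp [hx]
    refine ⟨outcomePrefix π x (π.symm i).castSucc, ?_, ?_⟩
    · rw [dagTree_isLeaf_iff]
      exact (π.symm i).2.ne
    · rw [sum_outEdges, hy]

theorem ker_psi_dagTree (hπ : G.IsLinearExtension π) :
    RingHom.ker ((dagTree R G hπ).psi (dagTreeLeaf R G hπ)) = RingHom.ker (phiDAG R G) := by
  have : (dagTree R G hπ).psi (dagTreeLeaf R G hπ) =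
      (Ideal.Quotient.mkₐ ℝ (dagTree R G hπ).stageIdeal).comp (aeval (dagMonomial R G)) := by
    ext x
    simp only [StagedTree.psi, rootPath_monomial, aeval_X, AlgHom.comp_apply,
      Ideal.Quotient.mkₐ_eq_mk]
  ext f
  rw [RingHom.mem_ker, RingHom.mem_ker, phiDAG_apply, this, AlgHom.comp_apply,
    Ideal.Quotient.mkₐ_eq_mk, Ideal.Quotient.eq_zero_iff_mem, Ideal.Quotient.eq_zero_iff_mem,
    stageIdeal_dagTree]

end Tree

theorem mainTheorem2 {p : ℕ} (R : Fin p → Type*) [∀ i, Fintype (R i)] [∀ i, Nontrivial (R i)]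
    (G : Digraph (Fin p)) (hG : G.IsDAG) (π : Equiv.Perm (Fin p))
    (hπ : G.IsLinearExtension π) :
    List.TFAE [
      G.IsPerfectDAG,
      RingHom.ker (phiDAG R G) = RingHom.ker (phiCliques R G.skeleton),
      RingHom.ker ((dagTree R G hπ).psi (dagTreeLeaf R G hπ)) =
        RingHom.ker ((dagTree R G hπ).psiToric (dagTreeLeaf R G hπ))] ∧
    ((G.IsPerfectDAG ∨
      RingHom.ker (phiDAG R G) = RingHom.ker (phiCliques R G.skeleton) ∨
      RingHom.ker ((dagTree R G hπ).psi (dagTreeLeaf R G hπ)) =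
        RingHom.ker ((dagTree R G hπ).psiToric (dagTreeLeaf R G hπ))) →
      RingHom.ker (phiCliques R G.skeleton) = RingHom.ker (phiDAG R G) ∧
      RingHom.ker (phiDAG R G) = RingHom.ker ((dagTree R G hπ).psi (dagTreeLeaf R G hπ)) ∧
      RingHom.ker ((dagTree R G hπ).psi (dagTreeLeaf R G hπ)) =
        RingHom.ker ((dagTree R G hπ).psiToric (dagTreeLeaf R G hπ))) := by
  rw [ker_psi_dagTree, psiToric_dagTree]
  have h12 (h : G.IsPerfectDAG) :
      RingHom.ker (phiDAG R G) = RingHom.ker (phiCliques R G.skeleton) :=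
    (h.ker_dagMonomial_eq hπ).symm.trans (h.ker_dagMonomial_eq_ker_phiCliques hπ)
  have h21 (h : RingHom.ker (phiDAG R G) = RingHom.ker (phiCliques R G.skeleton)) :
      G.IsPerfectDAG := by
    by_contra hn
    obtain ⟨f, hf, hf', -⟩ := exists_ciPoly_of_not_isPerfectDAG (R := R) hπ hn
    exact hf' (h ▸ hf)
  have h31 (h : RingHom.ker (phiDAG R G) = RingHom.ker
      (aeval (dagMonomial R G) : _ →ₐ[ℝ] MvPolynomial (Option (CondIndex R G)) ℝ)) :
      G.IsPerfectDAG := by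
    by_contra hn
    obtain ⟨f, hf, -, hf'⟩ := exists_ciPoly_of_not_isPerfectDAG (R := R) hπ hn
    exact hf' (h ▸ hf)
  refine ⟨?_, fun h => ?_⟩
  · tfae_have 1 → 2 := h12
    tfae_have 2 → 1 := h21
    tfae_have 1 → 3 := fun h => (h.ker_dagMonomial_eq hπ).symm
    tfae_have 3 → 1 := h31
    tfae_finish
  · have hp : G.IsPerfectDAG := h.elim id fun h => h.elim h21 h31
    exact ⟨(h12 hp).symm, rfl, (hp.ker_dagMonomial_eq hπ).symm⟩
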